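/- **Proposition (Answers to a SPARQL query modulo RDF Schema by PSPARQL).** *Terms, graphs, patterns.* Let $\mathcal U$ (urirefs), $\mathcal L$ (literals), $\mathcal B$ (variables/blanks) be pairwise disjoint sets with $\mathcal B$ infinite and with five distinguished urirefs $\rho\mathrm{df}=\{\mathsf{sc},\mathsf{sp},\mathsf{type},\mathsf{dom},\mathsf{range}\}$, and let $\mathcal T=\mathcal U\cup\mathcal L\cup\mathcal B$. An RDF triple is an element of $(\mathcal U\cup\mathcal B)\times\mathcal U\times\mathcal T$; an RDF graph $G$ is a set of RDF triples. It is *genuine* if elements of $\rho\mathrm{df}$ occur in it only in predicate position. Blanks of $G$ are treated as constants. SPARQL graph patterns are built from finite sets of triples (basic graph patterns) by AND, UNION, OPT and FILTER $K$, where a constraint $K$ is a Boolean function of the values of finitely many variables. PSPARQL graph patterns are built in the same way from finite sets of PRDF triples $\langle s,R,o\rangle$, where $R$ is a regular expression over urirefs and variables. *Entailment.* $G\models^{\mathrm{nrx}}_{\mathrm{RDFS}}H$ means that every reflexive relaxed $\rho\mathrm{df}$ model of $G$ is one of $H$, i.e. RDFS models for the core vocabulary $\rho\mathrm{df}$ ($I_{EXT}(\mathsf{sp})$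 and $I_{EXT}(\mathsf{sc})$ are transitive but need not be reflexive; $\langle x,y\rangle\in I_{EXT}(\mathsf{sp})$ implies $x,y\in I_P$ and $I_{EXT}(x)\subseteq I_{EXT}(y)$; $\langle x,y\rangle\in I_{EXT}(\mathsf{sc})$ implies $x,y\in Class$ and $I_{CEXT}(x)\subseteq I_{CEXT}(y)$; $x\in I_{CEXT}(y)$ iff $\langle x,y\rangle\in I_{EXT}(\mathsf{type})$; $\mathsf{dom}$ and $\mathsf{range}$ statements type the subjects, respectively objects, of the property and relate properties to classes; elements of $\rho\mathrm{df}$ denote properties). $G\models_{\mathrm{PRDF}}H$ means that every RDF interpretation that is a model of $G$ is a model of $H$, where $\langle s,R,o\rangle$ is satisfied if the resources denoted by $s$ and $o$ are linked by a path of property extensions that spells a word of the language of $R$ (the empty word requires equality). *Answers.* For an entailment relation $\models$, the set $\mathcal S(P,G)$ of partial maps $\sigma$ from $\mathcal B$ to $\mathcal T$ is defined by: $\mathcal S(F,G)=\{\sigma\mid \mathrm{dom}(\sigma)=\mathcal B(F),\ G\models\sigma(F)\}$ for a basic graph pattern $F$; AND is the join of sets of maps (unions $\sigma_1\oplus\sigma_2$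 of compatible maps), UNION is the union, $\mathcal S(P\ \mathrm{OPT}\ P')=(\mathcal S(P)\Join\mathcal S(P'))\cup(\mathcal S(P)\setminus\mathcal S(P'))$ where $\setminus$ keeps the maps that are compatible with no map of $\mathcal S(P')$, and FILTER $K$ keeps the maps that bind all variables of $K$ and make $K$ true. For a tuple $\vec B$ of variables, the answers are the maps $\sigma|_{\vec B}^{\vec B}$, $\sigma\in\mathcal S(P,G)$, restricted to $\vec B$ and completed by null. They are written $\mathcal A^{\#}(\vec B,G,P)$ for $\models^{\mathrm{nrx}}_{\mathrm{RDFS}}$ (SPARQL patterns) and $\mathcal A^{\star}(\vec B,G,P)$ for $\models_{\mathrm{PRDF}}$ (PSPARQL patterns). *Rewriting.* For an RDF triple, with new variables $?x,?p,?y$, put $$\begin{aligned} \tau(\langle s,\mathsf{sc},o\rangle)&=\{\langle s,\mathsf{sc}^+,o\rangle\},\qquad \tau(\langle s,\mathsf{sp},o\rangle)=\{\langle s,\mathsf{sp}^+,o\rangle\},\\ \tau(\langle s,p,o\rangle)&=\{\langle s,?x,o\rangle,\langle ?x,\mathsf{sp}^*,p\rangle\}\qquad(p\notin\{\mathsf{sc},\mathsf{sp},\mathsf{type}\}),\\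 \tau(\langle s,\mathsf{type},o\rangle)&=\{\langle s,\mathsf{type}\cdot\mathsf{sc}^*,o\rangle\}\\ &\quad\text{UNION }\{\langle s,?p,?y\rangle,\langle ?p,\mathsf{sp}^*\cdot\mathsf{dom}\cdot\mathsf{sc}^*,o\rangle\}\\ &\quad\text{UNION }\{\langle ?y,?p,s\rangle,\langle ?p,\mathsf{sp}^*\cdot\mathsf{range}\cdot\mathsf{sc}^*,o\rangle\}. \end{aligned}$$ For a SPARQL graph pattern $P$ all of whose triples are RDF triples (so predicates are urirefs), $\tau(P)$ replaces each basic graph pattern by the AND of the expansions of its triples and keeps AND, UNION, OPT and FILTER $K$. The new variables are pairwise distinct for different occurrences of triples and occur neither in $P$ nor in $\vec B$. *Claim.* For every genuine RDF graph $G$, every SPARQL graph pattern $P$ whose triples are RDF triples and every tuple $\vec B$ of variables, new variables as required exist, and for every choice of them $$\mathcal A^{\#}(\vec B,G,P)=\mathcal A^{\star}(\vec B,G,\tau(P)).$$ -/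

import Mathlib

universe u

namespace SparqlRdfs

/-- Urirefs: the five reserved words of the core RDF Schema vocabulary, and all other urirefs,
named by elements of `N`. -/
inductive Uri (N : Type u) : Type u
  | sc | sp | type | dom | range
  | name (n : N)

/-- Terms: urirefs, literals and variables (blanks), three pairwise disjoint sets. -/
inductive Term (N L B : Type u) : Type u
  | uri (a : Uri N)
  | lit (l : L)
  | var (b : B)

/-- Membership in the core vocabulary `{sc, sp, type, dom, range}`. -/
def Term.IsRho {N L B : Type u} : Term N L B → Prop
  | .uri .sc | .uri .sp | .uri .type | .uri .dom | .uri .range => True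
  | _ => False

/-- The variables occurring in a term. -/
def Term.vars {N L B : Type u} : Term N L B → Set B
  | .var b => {b}
  | _ => ∅

/-- Triples of terms.  Arbitrary terms are allowed in each position, because a substitution may
put, e.g., a literal in subject position; `IsRDF` singles out the RDF triples. -/
structure Triple (N L B : Type u) : Type u where
  s : Term N L B
  p : Term N L B
  o : Term N L B

/-- RDF triples: elements of `(U ∪ B) × U × T`. -/
def Triple.IsRDF {N L B : Type u} (t : Triple N L B) : Prop :=
  (∀ l, t.s ≠ .lit l) ∧ ∃ a, t.p = .uri a

def Triple.vars {N L B : Type u} (t : Triple N L B) : Set B :=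
  t.s.vars ∪ t.p.vars ∪ t.o.vars

/-- An RDF graph is a set of RDF triples. -/
def IsRDFGraph {N L B : Type u} (G : Set (Triple N L B)) : Prop :=
  ∀ t ∈ G, t.IsRDF

/-- Genuine graphs: the elements of the core vocabulary appear only in predicate position. -/
def IsGenuine {N L B : Type u} (G : Set (Triple N L B)) : Prop :=
  ∀ t ∈ G, ¬ t.s.IsRho ∧ ¬ t.o.IsRho

/-! ### Maps -/

/-- A map: a partial assignment of terms to variables (names are always preserved);
`none` means that the variable is outside the domain. -/
abbrev PMap (N L B : Type u) : Type u := B → Option (Term N L B)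

def PMap.dom {N L B : Type u} (σ : PMap N L B) : Set B := {b | σ b ≠ none}

def PMap.Compatible {N L B : Type u} (σ₁ σ₂ : PMap N L B) : Prop :=
  ∀ b, b ∈ σ₁.dom → b ∈ σ₂.dom → σ₁ b = σ₂ b

/-- The union `σ₁ ⊕ σ₂` of two (compatible) maps. -/
def PMap.merge {N L B : Type u} (σ₁ σ₂ : PMap N L B) : PMap N L B :=
  fun b => (σ₁ b).or (σ₂ b)

def join {N L B : Type u} (Ω₁ Ω₂ : Set (PMap N L B)) : Set (PMap N L B) :=
  {σ | ∃ σ₁ ∈ Ω₁, ∃ σ₂ ∈ Ω₂, σ₁.Compatible σ₂ ∧ σ = σ₁.merge σ₂}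

def diff {N L B : Type u} (Ω₁ Ω₂ : Set (PMap N L B)) : Set (PMap N L B) :=
  {σ₁ ∈ Ω₁ | ∀ σ₂ ∈ Ω₂, ¬ σ₁.Compatible σ₂}

def Term.subst {N L B : Type u} (σ : PMap N L B) : Term N L B → Term N L B
  | .var b => (σ b).getD (.var b)
  | t => t

def Triple.subst {N L B : Type u} (σ : PMap N L B) (t : Triple N L B) : Triple N L B :=
  ⟨t.s.subst σ, t.p.subst σ, t.o.subst σ⟩

/-! ### Regular expression patterns and PRDF triples -/

/-- Regular expression patterns.  A letter is a uriref or a variable (or what a substitution makes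
of a variable); `neg a` is the pattern `!a`. -/
inductive PathExpr (N L B : Type u) : Type u
  | letter (t : Term N L B)
  | neg (a : Uri N)
  | eps
  | alt (R S : PathExpr N L B)
  | seq (R S : PathExpr N L B)
  | star (R : PathExpr N L B)
  | plus (R : PathExpr N L B)

open scoped Computability in
/-- The language generated by a pattern; `!a` generates the one-letter words other than `a`
over the alphabet of urirefs. -/
def PathExpr.lang {N L B : Type u} : PathExpr N L B → Language (Term N L B)
  | .letter t => {[t]}
  | .neg a => {w | ∃ c : Uri N, c ≠ a ∧ w = [.uri c]}
  | .eps => 1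
  | .alt R S => R.lang + S.lang
  | .seq R S => R.lang * S.lang
  | .star R => (R.lang)∗
  | .plus R => R.lang * (R.lang)∗

def PathExpr.vars {N L B : Type u} : PathExpr N L B → Set B
  | .letter t => t.vars
  | .neg _ => ∅
  | .eps => ∅
  | .alt R S => R.vars ∪ S.vars
  | .seq R S => R.vars ∪ S.vars
  | .star R => R.vars
  | .plus R => R.vars

def PathExpr.subst {N L B : Type u} (σ : PMap N L B) : PathExpr N L B → PathExpr N L B
  | .letter t => .letter (t.subst σ)
  | .neg a => .neg a
  | .eps => .eps
  | .alt R S => .alt (R.subst σ) (S.subst σ)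
  | .seq R S => .seq (R.subst σ) (S.subst σ)
  | .star R => .star (R.subst σ)
  | .plus R => .plus (R.subst σ)

/-- PRDF triples: the predicate is a regular expression pattern. -/
structure PTriple (N L B : Type u) : Type u where
  s : Term N L B
  path : PathExpr N L B
  o : Term N L B

def PTriple.vars {N L B : Type u} (t : PTriple N L B) : Set B :=
  t.s.vars ∪ t.path.vars ∪ t.o.vars

def PTriple.subst {N L B : Type u} (σ : PMap N L B) (t : PTriple N L B) : PTriple N L B :=
  ⟨t.s.subst σ, t.path.subst σ, t.o.subst σ⟩

/-- Every RDF triple is a PRDF triple. -/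
def Triple.toPTriple {N L B : Type u} (t : Triple N L B) : PTriple N L B :=
  ⟨t.s, .letter t.p, t.o⟩

/-! ### Interpretations and entailment -/

/-- RDF interpretations (of the full vocabulary).  The blanks of a graph are treated as constants,
as if they were urirefs, so `ι` interprets all terms.  The extension function, which is defined on
`IP`, is extended by the empty relation.  Literals denote themselves: up to a renaming of
resources this says that distinct literals denote distinct resources. -/
structure Interp (N L B : Type u) : Type (u + 1) where
  R : Type u
  IP : Set R
  ext : R → R → R → Prop
  ext_mem : ∀ {p x y}, ext p x y → p ∈ IP
  ι : Term N L B → R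
  lit_inj : Function.Injective fun l : L => ι (.lit l)

/-- `I` is an RDF model of `G`. -/
def Interp.ModelsRDF {N L B : Type u} (I : Interp N L B) (G : Set (Triple N L B)) : Prop :=
  ∀ t ∈ G, I.ι t.p ∈ I.IP ∧ I.ext (I.ι t.p) (I.ι t.s) (I.ι t.o)

/-- The resources `x` and `y` are linked by a sequence of resources that follows a word. -/
def Interp.Follows {N L B : Type u} (I : Interp N L B) : List (Term N L B) → I.R → I.R → Prop
  | [], x, y => x = y
  | a :: w, x, y => ∃ z, I.ext (I.ι a) x z ∧ I.Follows w z y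

/-- The pair `(x, y)` supports the regular expression pattern `E` (the empty word requires
`x = y`). -/
def Interp.Supports {N L B : Type u} (I : Interp N L B) (E : PathExpr N L B) (x y : I.R) : Prop :=
  ∃ w ∈ E.lang, I.Follows w x y

/-- `I` is a PRDF model of `H`. -/
def Interp.ModelsPRDF {N L B : Type u} (I : Interp N L B) (H : Set (PTriple N L B)) : Prop :=
  ∀ t ∈ H, I.Supports t.path (I.ι t.s) (I.ι t.o)

/-- PRDF entailment. -/
def PRDFEntails {N L B : Type u} (G H : Set (PTriple N L B)) : Prop :=
  ∀ I : Interp N L B, I.ModelsPRDF G → I.ModelsPRDF H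

/-- RDFS interpretations: the set `Class` of classes, the class extensions (extended by the empty
set outside `Class`) and the set `Lit` of literal values are added. -/
structure RDFSInterp (N L B : Type u) : Type (u + 1) extends Interp N L B where
  Class : Set R
  cext : R → Set R
  cext_mem : ∀ {c x}, x ∈ cext c → c ∈ Class
  Lit : Set R
  lit_mem : ∀ l : L, ι (.lit l) ∈ Lit

/-- The reflexive relaxed models of `G` for the core vocabulary: the interpretations of `sp` and
`sc` are transitive, but need not be reflexive. -/
structure RDFSInterp.ModelsNrx {N L B : Type u} (I : RDFSInterp N L B)
    (G : Set (Triple N L B)) : Prop where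
  simple : I.ModelsRDF G
  sp_trans : ∀ x y z, I.ext (I.ι (.uri .sp)) x y → I.ext (I.ι (.uri .sp)) y z →
    I.ext (I.ι (.uri .sp)) x z
  sp_prop : ∀ x y, I.ext (I.ι (.uri .sp)) x y → x ∈ I.IP ∧ y ∈ I.IP
  sp_sub : ∀ x y, I.ext (I.ι (.uri .sp)) x y → ∀ u v, I.ext x u v → I.ext y u v
  sc_trans : ∀ x y z, I.ext (I.ι (.uri .sc)) x y → I.ext (I.ι (.uri .sc)) y z →
    I.ext (I.ι (.uri .sc)) x z
  sc_class : ∀ x y, I.ext (I.ι (.uri .sc)) x y → x ∈ I.Class ∧ y ∈ I.Class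
  sc_sub : ∀ x y, I.ext (I.ι (.uri .sc)) x y → I.cext x ⊆ I.cext y
  type_iff : ∀ x y, x ∈ I.cext y ↔ I.ext (I.ι (.uri .type)) x y
  dom_type : ∀ x y, I.ext (I.ι (.uri .dom)) x y → ∀ u v, I.ext x u v → u ∈ I.cext y
  range_type : ∀ x y, I.ext (I.ι (.uri .range)) x y → ∀ u v, I.ext x u v → v ∈ I.cext y
  rho_prop : ∀ e : Term N L B, e.IsRho → I.ι e ∈ I.IP
  dom_class : ∀ x y, I.ext (I.ι (.uri .dom)) x y → x ∈ I.IP ∧ y ∈ I.Class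
  range_class : ∀ x y, I.ext (I.ι (.uri .range)) x y → x ∈ I.IP ∧ y ∈ I.Class

/-- RDFS entailment under the reflexive relaxed semantics. -/
def NrxEntails {N L B : Type u} (G H : Set (Triple N L B)) : Prop :=
  ∀ I : RDFSInterp N L B, I.ModelsNrx G → I.ModelsNrx H

/-! ### Graph patterns and answers -/

/-- Constraints: arbitrary Boolean functions of the terms bound to finitely many variables. -/
structure Constraint (N L B : Type u) : Type u where
  vars : Finset B
  eval : ({b // b ∈ vars} → Term N L B) → Bool

/-- `σ(K) = ⊤`: all variables of `K` are bound by `σ`, and `K` evaluates to true. -/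
def Constraint.Holds {N L B : Type u} (K : Constraint N L B) (σ : PMap N L B) : Prop :=
  ∃ v : {b // b ∈ K.vars} → Term N L B, (∀ b, σ b.1 = some (v b)) ∧ K.eval v = true

/-- Graph patterns over basic graph patterns that are finite sets of triples of type `X`. -/
inductive Pattern (N L B X : Type u) : Type u
  | bgp (F : Finset X)
  | and (P Q : Pattern N L B X)
  | union (P Q : Pattern N L B X)
  | opt (P Q : Pattern N L B X)
  | filter (P : Pattern N L B X) (K : Constraint N L B)

/-- SPARQL and PSPARQL graph patterns. -/
abbrev SPattern (N L B : Type u) : Type u := Pattern N L B (Triple N L B)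

abbrev PSPattern (N L B : Type u) : Type u := Pattern N L B (PTriple N L B)

/-- All triples of a graph pattern satisfy `q`. -/
def Pattern.AllTriples {N L B X : Type u} (q : X → Prop) : Pattern N L B X → Prop
  | .bgp F => ∀ t ∈ F, q t
  | .and P Q => P.AllTriples q ∧ Q.AllTriples q
  | .union P Q => P.AllTriples q ∧ Q.AllTriples q
  | .opt P Q => P.AllTriples q ∧ Q.AllTriples q
  | .filter P _ => P.AllTriples q

/-- The variables occurring in a graph pattern, where `tv` gives those of a triple. -/
def Pattern.vars {N L B X : Type u} (tv : X → Set B) : Pattern N L B X → Set B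
  | .bgp F => {b | ∃ t ∈ F, b ∈ tv t}
  | .and P Q => P.vars tv ∪ Q.vars tv
  | .union P Q => P.vars tv ∪ Q.vars tv
  | .opt P Q => P.vars tv ∪ Q.vars tv
  | .filter P K => P.vars tv ∪ {b | b ∈ K.vars}

/-- The maps that are answers to a graph pattern, where `ent σ F` says that the queried graph
entails the instance `σ(F)` of the basic graph pattern `F`. -/
def Pattern.sol {N L B X : Type u} (tv : X → Set B) (ent : PMap N L B → Finset X → Prop) :
    Pattern N L B X → Set (PMap N L B)
  | .bgp F => {σ | σ.dom = {b | ∃ t ∈ F, b ∈ tv t} ∧ ent σ F}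
  | .and P Q => join (P.sol tv ent) (Q.sol tv ent)
  | .union P Q => P.sol tv ent ∪ Q.sol tv ent
  | .opt P Q => join (P.sol tv ent) (Q.sol tv ent) ∪ diff (P.sol tv ent) (Q.sol tv ent)
  | .filter P K => {σ ∈ P.sol tv ent | K.Holds σ}

/-- Restriction of a map to the distinguished variables, and completion by null (`none`). -/
def PMap.project {N L B : Type u} (V : List B) (σ : PMap N L B) :
    {b // b ∈ V} → Option (Term N L B) :=
  fun b => σ b.1

/-- Answers to a SPARQL query modulo RDF Schema (reflexive relaxed semantics). -/
def answersRDFS {N L B : Type u} (V : List B) (G : Set (Triple N L B)) (P : SPattern N L B) :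
    Set ({b // b ∈ V} → Option (Term N L B)) :=
  PMap.project V '' P.sol Triple.vars
    fun σ F => NrxEntails G {t | ∃ t₀ ∈ F, t = t₀.subst σ}

/-- Answers to a PSPARQL query. -/
def answersPSPARQL {N L B : Type u} (V : List B) (G : Set (Triple N L B)) (P : PSPattern N L B) :
    Set ({b // b ∈ V} → Option (Term N L B)) :=
  PMap.project V '' P.sol PTriple.vars
    fun σ F => PRDFEntails (Triple.toPTriple '' G) {t | ∃ t₀ ∈ F, t = t₀.subst σ}

/-! ### The rewriting -/

open scoped Classical in
/-- The expansion of a triple with predicate a uriref; `x` and `y` are the new variables.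
(Triples with another predicate are not RDF triples; the value there is irrelevant.) -/
noncomputable def tauTriple {N L B : Type u} (x y : B) (t : Triple N L B) : PSPattern N L B :=
  match t.p with
  | .uri .sc => .bgp {⟨t.s, .plus (.letter (.uri .sc)), t.o⟩}
  | .uri .sp => .bgp {⟨t.s, .plus (.letter (.uri .sp)), t.o⟩}
  | .uri .type =>
    .union
      (.bgp {⟨t.s, .seq (.letter (.uri .type)) (.star (.letter (.uri .sc))), t.o⟩})
      (.union
        (.bgp {⟨t.s, .letter (.var x), .var y⟩,
          ⟨.var x, .seq (.star (.letter (.uri .sp)))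
            (.seq (.letter (.uri .dom)) (.star (.letter (.uri .sc)))), t.o⟩})
        (.bgp {⟨.var y, .letter (.var x), t.s⟩,
          ⟨.var x, .seq (.star (.letter (.uri .sp)))
            (.seq (.letter (.uri .range)) (.star (.letter (.uri .sc)))), t.o⟩}))
  | p => .bgp {⟨t.s, .letter (.var x), t.o⟩, ⟨.var x, .star (.letter (.uri .sp)), p⟩}

/-- A supply of variables is split into two disjoint ones, so that different occurrences of
triples in a query receive different new variables. -/
def evenPart {B : Type u} (fresh : ℕ → B) : ℕ → B := fun n => fresh (2 * n)

def oddPart {B : Type u} (fresh : ℕ → B) : ℕ → B := fun n => fresh (2 * n + 1)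

/-- The expansions of the triples of a basic graph pattern, connected by `AND`. -/
noncomputable def tauList {N L B : Type u} :
    (ℕ → B) → List (Triple N L B) → PSPattern N L B
  | _, [] => .bgp ∅
  | fresh, t :: ts =>
    .and (tauTriple (evenPart fresh 0) (evenPart fresh 1) t) (tauList (oddPart fresh) ts)

/-- The rewriting `τ` of SPARQL graph patterns; the new variables are taken from `fresh`. -/
noncomputable def tau {N L B : Type u} : (ℕ → B) → SPattern N L B → PSPattern N L B
  | fresh, .bgp F => tauList fresh F.toList
  | fresh, .and P Q => .and (tau (evenPart fresh) P) (tau (oddPart fresh) Q)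
  | fresh, .union P Q => .union (tau (evenPart fresh) P) (tau (oddPart fresh) Q)
  | fresh, .opt P Q => .opt (tau (evenPart fresh) P) (tau (oddPart fresh) Q)
  | fresh, .filter P K => .filter (tau fresh P) K

/-- `fresh` lists pairwise distinct variables that do not occur in the query
`SELECT V WHERE P`. -/
structure IsFresh {N L B : Type u} (V : List B) (P : SPattern N L B) (fresh : ℕ → B) : Prop where
  inj : Function.Injective fresh
  not_select : ∀ n, fresh n ∉ V
  not_pattern : ∀ n, fresh n ∉ P.vars Triple.vars

end SparqlRdfs

namespace SparqlRdfs

open Relation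

variable {N L B : Type u}

/-! ### Path expressions in an interpretation -/

/-! Both entailments are reduced to reachability in `G` by canonical models whose resources are the
terms themselves. For PRDF, `G` read as an interpretation gives `prdfEntails_iff`: an entailed PRDF
triple is exactly a path of `G` spelling a word of the expression. For RDFS, the closure of `G`
under the rules gives `nrxEntails_iff`: an entailed triple is exactly one of `closureExt`. Since a
genuine graph never has a reserved word as subject or object, nothing can be derived about the
vocabulary itself, and one explicit description of the closure suffices: `sp` and `sc` are closed
transitively, other predicates are inherited along `sp`-paths, and types come from `type`, `dom` or
`range` followed by an `sc`-path.

This description matches the clauses of the rewriting, whose new variables witness the existential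
quantifiers. So the answers to a pattern should be those to its rewriting with the new variables
forgotten. The induction needs more, because forgetting commutes with AND and OPT only if it cannot
change compatibility. `Simulates X D S T` therefore forgets one fixed set `X` of new variables
throughout and records in `D` those that a subpattern may bind. Different subpatterns get disjoint
sets `D`, so their maps never share a new variable. Filters and selected variables avoid `X`, so
neither sees the forgetting. -/

theorem Interp.follows_append (I : Interp N L B) (v w : List (Term N L B)) (x y : I.R) :
    I.Follows (v ++ w) x y ↔ ∃ z, I.Follows v x z ∧ I.Follows w z y := by
  induction v generalizing x with
  | nil => simp [Interp.Follows]
  | cons a v ih =>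
    simp only [List.cons_append, Interp.Follows, ih]
    constructor
    · rintro ⟨z, h, z', h', h''⟩
      exact ⟨z', ⟨z, h, h'⟩, h''⟩
    · rintro ⟨z', ⟨z, h, h'⟩, h''⟩
      exact ⟨z, h, z', h', h''⟩

theorem Interp.supports_letter (I : Interp N L B) (a : Term N L B) (x y : I.R) :
    I.Supports (.letter a) x y ↔ I.ext (I.ι a) x y := by
  constructor
  · rintro ⟨w, hw, h⟩
    obtain rfl : w = [a] := hw
    obtain ⟨z, hz, rfl⟩ := h
    exact hz
  · exact fun h => ⟨[a], rfl, y, h, rfl⟩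

theorem Interp.supports_seq (I : Interp N L B) (E F : PathExpr N L B) (x y : I.R) :
    I.Supports (.seq E F) x y ↔ ∃ z, I.Supports E x z ∧ I.Supports F z y := by
  constructor
  · rintro ⟨w, hw, h⟩
    obtain ⟨u, hu, v, hv, rfl⟩ := Language.mem_mul.1 hw
    obtain ⟨z, h₁, h₂⟩ := (I.follows_append u v x y).1 h
    exact ⟨z, ⟨u, hu, h₁⟩, ⟨v, hv, h₂⟩⟩
  · rintro ⟨z, ⟨u, hu, h₁⟩, ⟨v, hv, h₂⟩⟩
    exact ⟨u ++ v, Language.append_mem_mul hu hv, (I.follows_append u v x y).2 ⟨z, h₁, h₂⟩⟩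

theorem Interp.supports_star (I : Interp N L B) (E : PathExpr N L B) (x y : I.R) :
    I.Supports (.star E) x y ↔ ReflTransGen (I.Supports E) x y := by
  constructor
  · rintro ⟨w, hw, h⟩
    obtain ⟨S, rfl, hS⟩ := Language.mem_kstar.1 hw
    clear hw
    induction S generalizing x with
    | nil =>
      obtain rfl : x = y := h
      exact .refl
    | cons v S ih =>
      obtain ⟨z, h₁, h₂⟩ := (I.follows_append v S.flatten x y).1 (by simpa using h)
      exact .head ⟨v, hS v (by simp), h₁⟩ (ih z (fun u hu => hS u (by simp [hu])) h₂)
  · intro h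
    induction h using ReflTransGen.head_induction_on with
    | refl => exact ⟨[], Language.nil_mem_kstar _, rfl⟩
    | head h _ ih =>
      obtain ⟨v, hv, h₁⟩ := h
      obtain ⟨w, hw, h₂⟩ := ih
      obtain ⟨S, rfl, hS⟩ := Language.mem_kstar.1 hw
      refine ⟨v ++ S.flatten, Language.mem_kstar.2 ⟨v :: S, by simp, ?_⟩,
        (I.follows_append v _ _ y).2 ⟨_, h₁, h₂⟩⟩
      intro u hu
      rcases List.mem_cons.1 hu with rfl | hu
      · exact hv
      · exact hS u hu

theorem Interp.supports_plus (I : Interp N L B) (E : PathExpr N L B) (x y : I.R) :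
    I.Supports (.plus E) x y ↔ TransGen (I.Supports E) x y := by
  -- The language of `plus` is by definition that of `E` followed by its star.
  have h : I.Supports (.plus E) x y ↔ I.Supports (.seq E (.star E)) x y := Iff.rfl
  simp only [h, I.supports_seq, I.supports_star, TransGen.head'_iff]

/-! ### PRDF entailment -/

/-- The triples of a graph with predicate `p`, as a relation. -/
def Edge (G : Set (Triple N L B)) (p x y : Term N L B) : Prop := ⟨x, p, y⟩ ∈ G

/-- A graph as an interpretation whose resources are the terms. -/
def graphInterp (G : Set (Triple N L B)) : Interp N L B where
  R := Term N L B
  IP := Set.univ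
  ext := Edge G
  ext_mem _ := trivial
  ι := id
  lit_inj _ _ h := by injection h

/-- In a model of `G`, the denotation map sends edges of `G` to extension pairs, so it carries paths
to paths with the same label. -/
theorem graphInterp_follows {G : Set (Triple N L B)} {I : Interp N L B}
    (hI : I.ModelsPRDF (Triple.toPTriple '' G)) {w : List (Term N L B)} {x y : Term N L B}
    (h : (graphInterp G).Follows w x y) : I.Follows w (I.ι x) (I.ι y) := by
  induction w generalizing x with
  | nil =>
    obtain rfl : x = y := h
    rfl
  | cons a w ih =>
    obtain ⟨z, hz, h⟩ := h
    exact ⟨I.ι z, (I.supports_letter _ _ _).1 (hI _ ⟨_, hz, rfl⟩), ih h⟩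

/-- The pairs of terms that are linked by a path in `G` spelling a word of `E`. -/
def PathRel (G : Set (Triple N L B)) (E : PathExpr N L B) (x y : Term N L B) : Prop :=
  (graphInterp G).Supports E x y

/-- The graph is a model of itself, and its paths persist in every other model. -/
theorem prdfEntails_iff (G : Set (Triple N L B)) (H : Set (PTriple N L B)) :
    PRDFEntails (Triple.toPTriple '' G) H ↔
      ∀ t ∈ H, PathRel G t.path t.s t.o := by
  constructor
  · intro h
    refine h (graphInterp G) ?_
    rintro _ ⟨t, ht, rfl⟩
    exact ((graphInterp G).supports_letter _ _ _).2 ht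
  · intro h I hI t ht
    obtain ⟨w, hw, h⟩ := h t ht
    exact ⟨w, hw, graphInterp_follows hI h⟩

/-! ### RDFS entailment -/

/-- The types that a graph assigns to a term before subclasses are taken into account. -/
def DirectType (G : Set (Triple N L B)) (x c : Term N L B) : Prop :=
  Edge G (.uri .type) x c ∨
    (∃ q p z, Edge G q x z ∧ ReflTransGen (Edge G (.uri .sp)) q p ∧ Edge G (.uri .dom) p c) ∨
    ∃ q p z, Edge G q z x ∧ ReflTransGen (Edge G (.uri .sp)) q p ∧ Edge G (.uri .range) p c

/-- The extensions of the terms in the closure of a genuine graph under the RDFS rules. -/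
def closureExt (G : Set (Triple N L B)) : Term N L B → Term N L B → Term N L B → Prop
  | .uri .sc, x, y => TransGen (Edge G (.uri .sc)) x y
  | .uri .sp, x, y => TransGen (Edge G (.uri .sp)) x y
  | .uri .type, x, y => ∃ c, DirectType G x c ∧ ReflTransGen (Edge G (.uri .sc)) c y
  | p, x, y => ∃ q, Edge G q x y ∧ ReflTransGen (Edge G (.uri .sp)) q p

/-- The predicates for which `closureExt` is not defined separately. -/
def IsPlain (p : Term N L B) : Prop := p ≠ .uri .sc ∧ p ≠ .uri .sp ∧ p ≠ .uri .type

theorem closureExt_of_isPlain (G : Set (Triple N L B)) {p : Term N L B} (hp : IsPlain p)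
    (x y : Term N L B) :
    closureExt G p x y ↔ ∃ q, Edge G q x y ∧ ReflTransGen (Edge G (.uri .sp)) q p := by
  obtain ⟨h₁, h₂, h₃⟩ := hp
  -- The fall-through clause of `closureExt` reduces only once `p` is a constructor.
  rcases p with (_ | _ | _ | _ | _ | _) | _ | _ <;> first | contradiction | rfl

theorem isPlain_of_not_isRho {p : Term N L B} (hp : ¬ p.IsRho) : IsPlain p := by
  refine ⟨?_, ?_, ?_⟩ <;> rintro rfl <;> exact hp trivial

/-! ### Reserved words in the closure of a genuine graph -/

section Genuine

variable {G : Set (Triple N L B)} (hG : IsGenuine G)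

include hG

/-- A nonempty `sp`-path ends in the object of a triple, where a genuine graph has no reserved word.
-/
theorem eq_of_sp_isRho {q p : Term N L B} (hp : p.IsRho)
    (h : ReflTransGen (Edge G (.uri .sp)) q p) : q = p := by
  rcases h.cases_tail with h | ⟨_, _, h⟩
  · exact h.symm
  · exact absurd hp (hG _ h).2

theorem not_isRho_of_transGen {p x y : Term N L B} (h : TransGen (Edge G p) x y) :
    ¬ x.IsRho ∧ ¬ y.IsRho := by
  obtain ⟨_, h₁, _⟩ := TransGen.head'_iff.1 h
  obtain ⟨_, _, h₂⟩ := TransGen.tail'_iff.1 h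
  exact ⟨(hG _ h₁).1, (hG _ h₂).2⟩

theorem closureExt_dom {x y : Term N L B} (h : closureExt G (.uri .dom) x y) :
    Edge G (.uri .dom) x y := by
  obtain ⟨q, h, hq⟩ := h
  obtain rfl := eq_of_sp_isRho hG (by trivial) hq
  exact h

theorem closureExt_range {x y : Term N L B} (h : closureExt G (.uri .range) x y) :
    Edge G (.uri .range) x y := by
  obtain ⟨q, h, hq⟩ := h
  obtain rfl := eq_of_sp_isRho hG (by trivial) hq
  exact h

end Genuine

theorem closureExt_of_edge {G : Set (Triple N L B)} {p x y : Term N L B} (h : Edge G p x y) :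
    closureExt G p x y := by
  by_cases hp : IsPlain p
  · exact (closureExt_of_isPlain G hp x y).2 ⟨p, h, .refl⟩
  · rcases p with (_ | _ | _ | _ | _ | _) | _ | _
    · exact .single h
    · exact .single h
    · exact ⟨y, .inl h, .refl⟩
    all_goals exact absurd ⟨nofun, nofun, nofun⟩ hp

/-- The closure of a graph as an RDFS interpretation whose resources are the terms. -/
def closureInterp (G : Set (Triple N L B)) : RDFSInterp N L B where
  R := Term N L B
  IP := Set.univ
  ext := closureExt G
  ext_mem _ := trivial
  ι := id
  lit_inj _ _ h := by injection h
  Class := Set.univ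
  cext c := {x | closureExt G (.uri .type) x c}
  cext_mem _ := trivial
  Lit := Set.univ
  lit_mem _ := trivial

/-- Every term is a property and a class here, so the membership conditions are trivial. Genuineness
is needed for `sp_sub`, `dom_type` and `range_type`: the properties they concern are not reserved
words, so their extensions are given by the `sp`-path clause. -/
theorem closureInterp_models {G : Set (Triple N L B)} (hG : IsGenuine G) :
    (closureInterp G).ModelsNrx G where
  simple _ ht := ⟨trivial, closureExt_of_edge ht⟩
  sp_trans _ _ _ h h' := TransGen.trans h h'
  sp_prop _ _ _ := ⟨trivial, trivial⟩
  sp_sub x y h u v h' := by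
    obtain ⟨hx, hy⟩ := not_isRho_of_transGen hG h
    obtain ⟨q, hq, hs⟩ := (closureExt_of_isPlain G (isPlain_of_not_isRho hx) u v).1 h'
    exact (closureExt_of_isPlain G (isPlain_of_not_isRho hy) u v).2
      ⟨q, hq, hs.trans (TransGen.to_reflTransGen h)⟩
  sc_trans _ _ _ h h' := TransGen.trans h h'
  sc_class _ _ _ := ⟨trivial, trivial⟩
  sc_sub _ _ h _ hz := by
    obtain ⟨c, hc, hs⟩ := hz
    exact ⟨c, hc, hs.trans (TransGen.to_reflTransGen h)⟩
  type_iff _ _ := Iff.rfl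
  dom_type x y h u v h' := by
    have h := closureExt_dom hG h
    obtain ⟨q, hq, hs⟩ := (closureExt_of_isPlain G (isPlain_of_not_isRho (hG _ h).1) u v).1 h'
    exact ⟨y, .inr (.inl ⟨q, x, v, hq, hs, h⟩), .refl⟩
  range_type x y h u v h' := by
    have h := closureExt_range hG h
    obtain ⟨q, hq, hs⟩ := (closureExt_of_isPlain G (isPlain_of_not_isRho (hG _ h).1) u v).1 h'
    exact ⟨y, .inr (.inr ⟨q, x, u, hq, hs, h⟩), .refl⟩
  rho_prop _ _ := trivial
  dom_class _ _ _ := ⟨trivial, trivial⟩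
  range_class _ _ _ := ⟨trivial, trivial⟩

/-! ### The closure holds in every reflexive relaxed model -/

section Soundness

variable {G : Set (Triple N L B)} {I : RDFSInterp N L B} (hI : I.ModelsNrx G)

include hI

theorem ext_of_sp {q p x y : Term N L B} (h : Edge G q x y)
    (hs : ReflTransGen (Edge G (.uri .sp)) q p) : I.ext (I.ι p) (I.ι x) (I.ι y) := by
  induction hs with
  | refl => exact (hI.simple _ h).2
  | tail _ h' ih => exact hI.sp_sub _ _ (hI.simple _ h').2 _ _ ih

theorem mem_cext_of_directType {x c : Term N L B} (h : DirectType G x c) :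
    I.ι x ∈ I.cext (I.ι c) := by
  rcases h with h | ⟨q, p, z, h, hs, hd⟩ | ⟨q, p, z, h, hs, hd⟩
  · exact (hI.type_iff _ _).2 (hI.simple _ h).2
  · exact hI.dom_type _ _ (hI.simple _ hd).2 _ _ (ext_of_sp hI h hs)
  · exact hI.range_type _ _ (hI.simple _ hd).2 _ _ (ext_of_sp hI h hs)

/-- Each edge of the paths that make up a closure triple corresponds to one semantic condition:
transitivity, inclusion of extensions, or typing by `dom` or `range`. -/
theorem ext_of_closureExt {p x y : Term N L B} (h : closureExt G p x y) :
    I.ext (I.ι p) (I.ι x) (I.ι y) := by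
  by_cases hp : IsPlain p
  · obtain ⟨q, hq, hs⟩ := (closureExt_of_isPlain G hp x y).1 h
    exact ext_of_sp hI hq hs
  · rcases p with (_ | _ | _ | _ | _ | _) | _ | _
    · replace h : TransGen (Edge G (.uri .sc)) x y := h
      induction h with
      | single h => exact (hI.simple _ h).2
      | tail _ h ih => exact hI.sc_trans _ _ _ ih (hI.simple _ h).2
    · replace h : TransGen (Edge G (.uri .sp)) x y := h
      induction h with
      | single h => exact (hI.simple _ h).2
      | tail _ h ih => exact hI.sp_trans _ _ _ ih (hI.simple _ h).2
    · obtain ⟨c, hc, hs⟩ := h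
      refine (hI.type_iff _ _).1 ?_
      induction hs with
      | refl => exact mem_cext_of_directType hI hc
      | tail _ h ih => exact hI.sc_sub _ _ (hI.simple _ h).2 ih
    all_goals exact absurd ⟨nofun, nofun, nofun⟩ hp

end Soundness

theorem nrxEntails_iff {G : Set (Triple N L B)} (hG : IsGenuine G) (H : Set (Triple N L B)) :
    NrxEntails G H ↔ ∀ t ∈ H, closureExt G t.p t.s t.o := by
  constructor
  · exact fun h t ht => ((h _ (closureInterp_models hG)).simple t ht).2
  · intro h I hI
    -- Only the condition `simple` refers to the graph.
    refine { hI with simple := fun t ht => ?_ }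
    have := ext_of_closureExt hI (h t ht)
    exact ⟨I.ext_mem this, this⟩

/-! ### Restricting maps -/

theorem Term.subst_congr {σ σ' : PMap N L B} {t : Term N L B} (h : ∀ b ∈ t.vars, σ b = σ' b) :
    t.subst σ = t.subst σ' := by
  cases t with
  | var b => simp only [Term.subst, h b rfl]
  | _ => rfl

theorem Triple.subst_congr {σ σ' : PMap N L B} {t : Triple N L B}
    (h : ∀ b ∈ t.vars, σ b = σ' b) : t.subst σ = t.subst σ' := by
  simp only [Triple.subst, Term.subst_congr fun b hb => h b (.inl (.inl hb)),
    Term.subst_congr fun b hb => h b (.inl (.inr hb)), Term.subst_congr fun b hb => h b (.inr hb)]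

open scoped Classical in
/-- The restriction of a map to the complement of `X`. -/
noncomputable def PMap.forget (X : Set B) (σ : PMap N L B) : PMap N L B :=
  fun b => if b ∈ X then none else σ b

theorem PMap.forget_apply_of_mem {X : Set B} {b : B} (h : b ∈ X) (σ : PMap N L B) :
    σ.forget X b = none := if_pos h

theorem PMap.forget_apply {X : Set B} {b : B} (h : b ∉ X) (σ : PMap N L B) :
    σ.forget X b = σ b := if_neg h

theorem PMap.dom_forget (X : Set B) (σ : PMap N L B) : (σ.forget X).dom = σ.dom \ X := by
  ext b
  by_cases h : b ∈ X <;> simp [PMap.dom, PMap.forget, h]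

theorem PMap.dom_merge (σ₁ σ₂ : PMap N L B) : (σ₁.merge σ₂).dom = σ₁.dom ∪ σ₂.dom := by
  ext b
  cases h : σ₁ b <;> simp [PMap.dom, PMap.merge, h]

theorem PMap.forget_merge (X : Set B) (σ₁ σ₂ : PMap N L B) :
    (σ₁.merge σ₂).forget X = (σ₁.forget X).merge (σ₂.forget X) := by
  funext b
  by_cases h : b ∈ X <;> simp [PMap.merge, PMap.forget, h]

theorem PMap.merge_apply_left {σ₁ σ₂ : PMap N L B} {b : B} (h : b ∈ σ₁.dom) :
    σ₁.merge σ₂ b = σ₁ b := by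
  obtain ⟨a, ha⟩ := Option.ne_none_iff_exists'.1 h
  simp [PMap.merge, ha]

theorem PMap.merge_apply_right {σ₁ σ₂ : PMap N L B} (hc : σ₁.Compatible σ₂) {b : B}
    (h : b ∈ σ₂.dom) : σ₁.merge σ₂ b = σ₂ b := by
  by_cases h₁ : b ∈ σ₁.dom
  · rw [PMap.merge_apply_left h₁, hc b h₁ h]
  · have : σ₁ b = none := not_not.1 h₁
    simp [PMap.merge, this]

/-- Forgetting `X` only drops the requirement to agree on shared variables of `X`, and there are
none. -/
theorem PMap.compatible_forget {X : Set B} {σ₁ σ₂ : PMap N L B}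
    (h : Disjoint (σ₁.dom ∩ X) (σ₂.dom ∩ X)) :
    (σ₁.forget X).Compatible (σ₂.forget X) ↔ σ₁.Compatible σ₂ := by
  simp only [PMap.Compatible, PMap.dom_forget]
  constructor
  · intro hc b h₁ h₂
    by_cases hb : b ∈ X
    · exact absurd ⟨h₂, hb⟩ (Set.disjoint_left.1 h ⟨h₁, hb⟩)
    · simpa only [PMap.forget_apply hb] using hc b ⟨h₁, hb⟩ ⟨h₂, hb⟩
  · intro hc b h₁ h₂
    simpa only [PMap.forget_apply h₁.2] using hc b h₁.1 h₂.1

theorem forget_image_join {X : Set B} {S T : Set (PMap N L B)}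
    (h : ∀ σ₁ ∈ S, ∀ σ₂ ∈ T, Disjoint (σ₁.dom ∩ X) (σ₂.dom ∩ X)) :
    PMap.forget X '' join S T = join (PMap.forget X '' S) (PMap.forget X '' T) := by
  ext σ
  constructor
  · rintro ⟨_, ⟨σ₁, h₁, σ₂, h₂, hc, rfl⟩, rfl⟩
    exact ⟨_, ⟨σ₁, h₁, rfl⟩, _, ⟨σ₂, h₂, rfl⟩,
      (PMap.compatible_forget (h σ₁ h₁ σ₂ h₂)).2 hc, PMap.forget_merge X σ₁ σ₂⟩
  · rintro ⟨_, ⟨σ₁, h₁, rfl⟩, _, ⟨σ₂, h₂, rfl⟩, hc, rfl⟩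
    exact ⟨_, ⟨σ₁, h₁, σ₂, h₂, (PMap.compatible_forget (h σ₁ h₁ σ₂ h₂)).1 hc, rfl⟩,
      PMap.forget_merge X σ₁ σ₂⟩

/-- Without disjointness, forgetting could make incompatible maps compatible and so remove maps from
the difference. -/
theorem forget_image_diff {X : Set B} {S T : Set (PMap N L B)}
    (h : ∀ σ₁ ∈ S, ∀ σ₂ ∈ T, Disjoint (σ₁.dom ∩ X) (σ₂.dom ∩ X)) :
    PMap.forget X '' diff S T = diff (PMap.forget X '' S) (PMap.forget X '' T) := by
  ext σ
  constructor
  · rintro ⟨σ₁, ⟨h₁, hd⟩, rfl⟩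
    refine ⟨⟨σ₁, h₁, rfl⟩, ?_⟩
    rintro _ ⟨σ₂, h₂, rfl⟩ hc
    exact hd σ₂ h₂ ((PMap.compatible_forget (h σ₁ h₁ σ₂ h₂)).1 hc)
  · rintro ⟨⟨σ₁, h₁, rfl⟩, hd⟩
    exact ⟨σ₁, ⟨h₁, fun σ₂ h₂ hc =>
      hd _ ⟨σ₂, h₂, rfl⟩ ((PMap.compatible_forget (h σ₁ h₁ σ₂ h₂)).2 hc)⟩, rfl⟩

theorem Constraint.holds_forget {X : Set B} (K : Constraint N L B) (h : ∀ b ∈ K.vars, b ∉ X)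
    (σ : PMap N L B) : K.Holds (σ.forget X) ↔ K.Holds σ := by
  refine exists_congr fun v => and_congr_left' (forall_congr' fun b => ?_)
  rw [PMap.forget_apply (h b.1 b.2)]

theorem PMap.project_forget {X : Set B} {V : List B} (h : ∀ b ∈ V, b ∉ X) (σ : PMap N L B) :
    (σ.forget X).project V = σ.project V :=
  funext fun b => PMap.forget_apply (h b.1 b.2) σ

theorem PMap.forget_eq_self {X : Set B} {σ : PMap N L B} (h : Disjoint σ.dom X) :
    σ.forget X = σ := by
  funext b
  by_cases hb : b ∈ X
  · rw [PMap.forget_apply_of_mem hb]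
    exact (not_not.1 fun hn => Set.disjoint_left.1 h hn hb).symm
  · exact PMap.forget_apply hb σ

open scoped Classical in
/-- The map `σ` with the values at `x` and `y` replaced. -/
noncomputable def PMap.bind (σ : PMap N L B) (x y : B) (q z : Term N L B) : PMap N L B :=
  Function.update (Function.update σ x (some q)) y (some z)

theorem PMap.dom_bind (σ : PMap N L B) (x y : B) (q z : Term N L B) :
    (σ.bind x y q z).dom = σ.dom ∪ {x, y} := by
  ext b
  by_cases h₂ : b = y
  · simp [PMap.dom, PMap.bind, h₂]
  · by_cases h₁ : b = x
    · subst h₁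
      simp [PMap.dom, PMap.bind, h₂]
    · simp [PMap.dom, PMap.bind, h₁, h₂]

theorem PMap.forget_bind {X : Set B} {σ : PMap N L B} (h : Disjoint σ.dom X) {x y : B}
    (hx : x ∈ X) (hy : y ∈ X) (q z : Term N L B) : (σ.bind x y q z).forget X = σ := by
  funext b
  by_cases hb : b ∈ X
  · rw [PMap.forget_apply_of_mem hb, ← PMap.forget_apply_of_mem hb σ, PMap.forget_eq_self h]
  · have h₁ : b ≠ x := fun h => hb (h ▸ hx)
    have h₂ : b ≠ y := fun h => hb (h ▸ hy)
    simp [PMap.forget_apply hb, PMap.bind, h₁, h₂]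

/-- The maps in `S` are those in `T` with the bindings of the variables in `X` forgotten, and the
maps in `T` bind no variables in `X` except those in `D`. -/
structure Simulates (X D : Set B) (S T : Set (PMap N L B)) : Prop where
  image : PMap.forget X '' T = S
  dom_subset : ∀ σ ∈ T, σ.dom ∩ X ⊆ D

/-! ### Simulation is preserved by the pattern operators -/

namespace Simulates

variable {X D D₁ D₂ : Set B} {S S₁ S₂ T T₁ T₂ : Set (PMap N L B)}

theorem mono (h : Simulates X D₁ S T) (hD : D₁ ⊆ D₂) : Simulates X D₂ S T :=
  ⟨h.image, fun σ hσ => (h.dom_subset σ hσ).trans hD⟩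

theorem disjoint_dom (h₁ : Simulates X D₁ S₁ T₁) (h₂ : Simulates X D₂ S₂ T₂)
    (hD : Disjoint D₁ D₂) :
    ∀ σ₁ ∈ T₁, ∀ σ₂ ∈ T₂, Disjoint (σ₁.dom ∩ X) (σ₂.dom ∩ X) :=
  fun σ₁ hσ₁ σ₂ hσ₂ => hD.mono (h₁.dom_subset σ₁ hσ₁) (h₂.dom_subset σ₂ hσ₂)

theorem join (h₁ : Simulates X D₁ S₁ T₁) (h₂ : Simulates X D₂ S₂ T₂) (hD : Disjoint D₁ D₂) :
    Simulates X (D₁ ∪ D₂) (join S₁ S₂) (join T₁ T₂) where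
  image := by rw [forget_image_join (h₁.disjoint_dom h₂ hD), h₁.image, h₂.image]
  dom_subset := by
    rintro _ ⟨σ₁, hσ₁, σ₂, hσ₂, -, rfl⟩
    rw [PMap.dom_merge, Set.union_inter_distrib_right]
    exact Set.union_subset_union (h₁.dom_subset σ₁ hσ₁) (h₂.dom_subset σ₂ hσ₂)

theorem diff (h₁ : Simulates X D₁ S₁ T₁) (h₂ : Simulates X D₂ S₂ T₂) (hD : Disjoint D₁ D₂) :
    Simulates X D₁ (diff S₁ S₂) (diff T₁ T₂) where
  image := by rw [forget_image_diff (h₁.disjoint_dom h₂ hD), h₁.image, h₂.image]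
  dom_subset σ hσ := h₁.dom_subset σ hσ.1

theorem union (h₁ : Simulates X D S₁ T₁) (h₂ : Simulates X D S₂ T₂) :
    Simulates X D (S₁ ∪ S₂) (T₁ ∪ T₂) where
  image := by rw [Set.image_union, h₁.image, h₂.image]
  dom_subset σ hσ := hσ.elim (h₁.dom_subset σ) (h₂.dom_subset σ)

theorem filter (h : Simulates X D S T) (K : Constraint N L B) (hK : ∀ b ∈ K.vars, b ∉ X) :
    Simulates X D {σ ∈ S | K.Holds σ} {σ ∈ T | K.Holds σ} where
  image := by
    ext σ
    rw [← h.image]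
    constructor
    · rintro ⟨σ', ⟨h₁, h₂⟩, rfl⟩
      exact ⟨⟨σ', h₁, rfl⟩, (K.holds_forget hK σ').2 h₂⟩
    · rintro ⟨⟨σ', h₁, rfl⟩, h₂⟩
      exact ⟨σ', ⟨h₁, (K.holds_forget hK σ').1 h₂⟩, rfl⟩
  dom_subset σ hσ := h.dom_subset σ hσ.1

theorem of_disjoint (h : ∀ σ ∈ S, Disjoint σ.dom X) : Simulates X D S S where
  image := by
    ext σ
    constructor
    · rintro ⟨σ, hσ, rfl⟩
      rwa [PMap.forget_eq_self (h σ hσ)]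
    · exact fun hσ => ⟨σ, hσ, PMap.forget_eq_self (h σ hσ)⟩
  dom_subset σ hσ := by rw [(h σ hσ).inter_eq]; exact Set.empty_subset D

/-- Existential quantification as projection: `p` says that values for `x` and `y` exist, while `r`
reads them off the map. -/
theorem of_bind {A : Set B} {x y : B} {p r : PMap N L B → Prop} (hA : Disjoint A X) (hx : x ∈ X)
    (hy : y ∈ X) (h₁ : ∀ σ, r σ → p (σ.forget X))
    (h₂ : ∀ σ, σ.dom = A → p σ → ∃ q z, r (σ.bind x y q z)) :
    Simulates X {x, y} {σ | σ.dom = A ∧ p σ} {σ | σ.dom = A ∪ {x, y} ∧ r σ} where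
  image := by
    have hxy : ({x, y} : Set B) ⊆ X := Set.insert_subset hx (Set.singleton_subset_iff.2 hy)
    ext σ
    constructor
    · rintro ⟨σ, ⟨hd, hr⟩, rfl⟩
      refine ⟨?_, h₁ σ hr⟩
      rw [PMap.dom_forget, hd, Set.union_sdiff_distrib, hA.sdiff_eq_left,
        Set.sdiff_eq_empty.2 hxy, Set.union_empty]
    · rintro ⟨hd, hp⟩
      obtain ⟨q, z, hr⟩ := h₂ σ hd hp
      exact ⟨_, ⟨by rw [PMap.dom_bind, hd], hr⟩, PMap.forget_bind (hd ▸ hA) hx hy q z⟩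
  dom_subset := by
    rintro σ ⟨hd, -⟩ b ⟨hb, hX⟩
    rw [hd] at hb
    exact hb.resolve_left fun h => Set.disjoint_left.1 hA h hX

end Simulates

/-! ### Solutions of patterns -/

/-- The maps that answer a PSPARQL pattern. -/
abbrev pathSol (G : Set (Triple N L B)) (P : PSPattern N L B) : Set (PMap N L B) :=
  P.sol PTriple.vars
    fun σ F => PRDFEntails (Triple.toPTriple '' G) {t | ∃ t₀ ∈ F, t = t₀.subst σ}

/-- The maps that answer a SPARQL pattern modulo RDF Schema. -/
abbrev rdfsSol (G : Set (Triple N L B)) (P : SPattern N L B) : Set (PMap N L B) :=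
  P.sol Triple.vars fun σ F => NrxEntails G {t | ∃ t₀ ∈ F, t = t₀.subst σ}

/-- `t` holds in the closure of `G`. -/
def Holds (G : Set (Triple N L B)) (t : Triple N L B) : Prop := closureExt G t.p t.s t.o

theorem pathSol_bgp (G : Set (Triple N L B)) (F : Finset (PTriple N L B)) :
    pathSol G (.bgp F) = {σ | σ.dom = {b | ∃ t ∈ F, b ∈ t.vars} ∧
      ∀ t ∈ F, PathRel G (t.path.subst σ) (t.s.subst σ) (t.o.subst σ)} := by
  ext σ
  refine and_congr_right' ?_
  refine (prdfEntails_iff G _).trans ⟨fun h t ht => h _ ⟨t, ht, rfl⟩, ?_⟩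
  rintro h _ ⟨t, ht, rfl⟩
  exact h t ht

theorem pathSol_singleton (G : Set (Triple N L B)) (t : PTriple N L B) :
    pathSol G (.bgp {t}) = {σ | σ.dom = t.vars ∧
      PathRel G (t.path.subst σ) (t.s.subst σ) (t.o.subst σ)} := by
  simp [pathSol_bgp]

open scoped Classical in
theorem pathSol_pair (G : Set (Triple N L B)) (t t' : PTriple N L B) :
    pathSol G (.bgp {t, t'}) = {σ | σ.dom = t.vars ∪ t'.vars ∧
      PathRel G (t.path.subst σ) (t.s.subst σ) (t.o.subst σ) ∧
      PathRel G (t'.path.subst σ) (t'.s.subst σ) (t'.o.subst σ)} := by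
  simp [pathSol_bgp, Set.union_def]

theorem pathRel_letter (G : Set (Triple N L B)) (a : Term N L B) :
    PathRel G (.letter a) = Edge G a :=
  funext₂ fun x y => propext ((graphInterp G).supports_letter a x y)

theorem pathRel_star (G : Set (Triple N L B)) (a : Term N L B) (x y : Term N L B) :
    PathRel G (.star (.letter a)) x y ↔ ReflTransGen (Edge G a) x y := by
  rw [← pathRel_letter]
  exact (graphInterp G).supports_star _ x y

theorem pathRel_plus (G : Set (Triple N L B)) (a : Term N L B) (x y : Term N L B) :
    PathRel G (.plus (.letter a)) x y ↔ TransGen (Edge G a) x y := by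
  rw [← pathRel_letter]
  exact (graphInterp G).supports_plus _ x y

theorem pathRel_seq (G : Set (Triple N L B)) (a : Term N L B) (E : PathExpr N L B)
    (x y : Term N L B) :
    PathRel G (.seq (.letter a) E) x y ↔
      ∃ z, Edge G a x z ∧ PathRel G E z y := by
  rw [← pathRel_letter]
  exact (graphInterp G).supports_seq _ _ x y

theorem pathRel_star_seq (G : Set (Triple N L B)) (a b c : Term N L B)
    (x y : Term N L B) :
    PathRel G (.seq (.star (.letter a)) (.seq (.letter b) (.star (.letter c)))) x y ↔
      ∃ p z, ReflTransGen (Edge G a) x p ∧ Edge G b p z ∧ ReflTransGen (Edge G c) z y := by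
  refine ((graphInterp G).supports_seq _ _ x y).trans (exists_congr fun p => ?_)
  refine (and_congr (pathRel_star G a x p) (pathRel_seq G b _ p y)).trans ?_
  simp only [pathRel_star, exists_and_left]

theorem Term.subst_forget {X : Set B} {t : Term N L B} (h : Disjoint t.vars X)
    (σ : PMap N L B) : t.subst (σ.forget X) = t.subst σ :=
  Term.subst_congr fun _ hb => PMap.forget_apply (Set.disjoint_left.1 h hb) σ

theorem Term.subst_bind {X : Set B} {t : Term N L B} (h : Disjoint t.vars X)
    (σ : PMap N L B) {x y : B} (hx : x ∈ X) (hy : y ∈ X) (q z : Term N L B) :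
    t.subst (σ.bind x y q z) = t.subst σ := by
  refine Term.subst_congr fun b hb => ?_
  have hb := Set.disjoint_left.1 h hb
  have h₁ : b ≠ x := fun h => hb (h ▸ hx)
  have h₂ : b ≠ y := fun h => hb (h ▸ hy)
  simp [PMap.bind, h₁, h₂]

theorem Term.subst_var_bind_left {σ : PMap N L B} {x y : B} (h : x ≠ y) (q z : Term N L B) :
    (Term.var x).subst (σ.bind x y q z) = q := by
  simp [Term.subst, PMap.bind, h]

theorem Term.subst_var_bind_right {σ : PMap N L B} {x y : B} (q z : Term N L B) :
    (Term.var y).subst (σ.bind x y q z) = z := by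
  simp [Term.subst, PMap.bind]

/-! ### The rewriting of a triple -/

section TauTriple

variable {X : Set B} (G : Set (Triple N L B)) {s o : Term N L B} (hs : Disjoint s.vars X)
  (ho : Disjoint o.vars X) {x y : B} (hx : x ∈ X) (hy : y ∈ X)

include hs ho

open scoped Classical in
include hx in
theorem simulates_tau_plain (a : Uri N) :
    Simulates X {x}
      {σ | σ.dom = s.vars ∪ o.vars ∧ ∃ q, Edge G q (s.subst σ) (o.subst σ) ∧
        ReflTransGen (Edge G (.uri .sp)) q (.uri a)}
      (pathSol G (.bgp {⟨s, .letter (.var x), o⟩,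
        ⟨.var x, .star (.letter (.uri .sp)), .uri a⟩})) := by
  -- This clause has a single new variable, so it fills both slots of `of_bind`.
  have h := Simulates.of_bind (A := s.vars ∪ o.vars) (x := x) (y := x)
    (p := fun σ => ∃ q, Edge G q (s.subst σ) (o.subst σ) ∧
        ReflTransGen (Edge G (.uri .sp)) q (.uri a))
    (r := fun σ => Edge G ((Term.var x).subst σ) (s.subst σ) (o.subst σ) ∧
        ReflTransGen (Edge G (.uri .sp)) ((Term.var x).subst σ) (.uri a))
    (Set.disjoint_union_left.2 ⟨hs, ho⟩) hx hx ?_ ?_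
  · rw [Set.pair_eq_singleton] at h
    convert h using 1
    rw [pathSol_pair]
    ext σ
    simp only [PathExpr.subst, pathRel_letter, PTriple.vars, PathExpr.vars, Term.vars]
    refine and_congr ?_ (and_congr_right' (pathRel_star ..))
    refine Eq.congr_right ?_
    ext b
    simp only [Set.mem_union, Set.mem_singleton_iff, Set.mem_empty_iff_false]
    tauto
  · intro σ h
    simp only [Term.subst_forget hs, Term.subst_forget ho]
    exact ⟨_, h⟩
  · rintro σ - ⟨q, h⟩
    refine ⟨q, q, ?_⟩
    simpa only [Term.subst_bind hs σ hx hx, Term.subst_bind ho σ hx hx, Term.subst_var_bind_right]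
      using h

open scoped Classical in
include hx hy in
theorem simulates_tau_dom (hxy : x ≠ y) :
    Simulates X {x, y}
      {σ | σ.dom = s.vars ∪ o.vars ∧ ∃ c, (∃ q p z, Edge G q (s.subst σ) z ∧
        ReflTransGen (Edge G (.uri .sp)) q p ∧ Edge G (.uri .dom) p c) ∧
        ReflTransGen (Edge G (.uri .sc)) c (o.subst σ)}
      (pathSol G (.bgp {⟨s, .letter (.var x), .var y⟩,
          ⟨.var x, .seq (.star (.letter (.uri .sp)))
            (.seq (.letter (.uri .dom)) (.star (.letter (.uri .sc)))), o⟩})) := by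
  have h := Simulates.of_bind (A := s.vars ∪ o.vars) (x := x) (y := y)
    (p := fun σ => ∃ c, (∃ q p z, Edge G q (s.subst σ) z ∧
        ReflTransGen (Edge G (.uri .sp)) q p ∧ Edge G (.uri .dom) p c) ∧
        ReflTransGen (Edge G (.uri .sc)) c (o.subst σ))
    (r := fun σ => Edge G ((Term.var x).subst σ) (s.subst σ) ((Term.var y).subst σ) ∧
      ∃ p c, ReflTransGen (Edge G (.uri .sp)) ((Term.var x).subst σ) p ∧
        Edge G (.uri .dom) p c ∧ ReflTransGen (Edge G (.uri .sc)) c (o.subst σ))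
    (Set.disjoint_union_left.2 ⟨hs, ho⟩) hx hy ?_ ?_
  · convert h using 1
    rw [pathSol_pair]
    ext σ
    simp only [PathExpr.subst, pathRel_letter, PTriple.vars, PathExpr.vars, Term.vars]
    refine and_congr ?_ (and_congr_right' (pathRel_star_seq ..))
    refine Eq.congr_right ?_
    ext b
    simp only [Set.mem_union, Set.mem_insert_iff, Set.mem_singleton_iff, Set.mem_empty_iff_false]
    tauto
  · rintro σ ⟨h₁, p, c, h₂, h₃, h₄⟩
    simp only [Term.subst_forget hs, Term.subst_forget ho]
    exact ⟨c, ⟨_, p, _, h₁, h₂, h₃⟩, h₄⟩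
  · rintro σ - ⟨c, ⟨q, p, z, h₁, h₂, h₃⟩, h₄⟩
    refine ⟨q, z, ?_⟩
    simp only [Term.subst_bind hs σ hx hy, Term.subst_bind ho σ hx hy, Term.subst_var_bind_right,
      Term.subst_var_bind_left hxy]
    exact ⟨h₁, p, c, h₂, h₃, h₄⟩

open scoped Classical in
include hx hy in
theorem simulates_tau_range (hxy : x ≠ y) :
    Simulates X {x, y}
      {σ | σ.dom = s.vars ∪ o.vars ∧ ∃ c, (∃ q p z, Edge G q z (s.subst σ) ∧
        ReflTransGen (Edge G (.uri .sp)) q p ∧ Edge G (.uri .range) p c) ∧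
        ReflTransGen (Edge G (.uri .sc)) c (o.subst σ)}
      (pathSol G (.bgp {⟨.var y, .letter (.var x), s⟩,
          ⟨.var x, .seq (.star (.letter (.uri .sp)))
            (.seq (.letter (.uri .range)) (.star (.letter (.uri .sc)))), o⟩})) := by
  have h := Simulates.of_bind (A := s.vars ∪ o.vars) (x := x) (y := y)
    (p := fun σ => ∃ c, (∃ q p z, Edge G q z (s.subst σ) ∧
        ReflTransGen (Edge G (.uri .sp)) q p ∧ Edge G (.uri .range) p c) ∧
        ReflTransGen (Edge G (.uri .sc)) c (o.subst σ))
    (r := fun σ => Edge G ((Term.var x).subst σ) ((Term.var y).subst σ) (s.subst σ) ∧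
      ∃ p c, ReflTransGen (Edge G (.uri .sp)) ((Term.var x).subst σ) p ∧
        Edge G (.uri .range) p c ∧ ReflTransGen (Edge G (.uri .sc)) c (o.subst σ))
    (Set.disjoint_union_left.2 ⟨hs, ho⟩) hx hy ?_ ?_
  · convert h using 1
    rw [pathSol_pair]
    ext σ
    simp only [PathExpr.subst, pathRel_letter, PTriple.vars, PathExpr.vars, Term.vars]
    refine and_congr ?_ (and_congr_right' (pathRel_star_seq ..))
    refine Eq.congr_right ?_
    ext b
    simp only [Set.mem_union, Set.mem_insert_iff, Set.mem_singleton_iff, Set.mem_empty_iff_false]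
    tauto
  · rintro σ ⟨h₁, p, c, h₂, h₃, h₄⟩
    simp only [Term.subst_forget hs, Term.subst_forget ho]
    exact ⟨c, ⟨_, p, _, h₁, h₂, h₃⟩, h₄⟩
  · rintro σ - ⟨c, ⟨q, p, z, h₁, h₂, h₃⟩, h₄⟩
    refine ⟨q, z, ?_⟩
    simp only [Term.subst_bind hs σ hx hy, Term.subst_bind ho σ hx hy, Term.subst_var_bind_right,
      Term.subst_var_bind_left hxy]
    exact ⟨h₁, p, c, h₂, h₃, h₄⟩

/-- No new variable is bound here, so `D` is arbitrary; the `type` expansion uses this to unite its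
first alternative with the other two. -/
theorem simulates_singleton {D : Set B} {E : PathExpr N L B} (hE : E.vars = ∅)
    {p : PMap N L B → Prop}
    (h : ∀ σ, p σ ↔ PathRel G (E.subst σ) (s.subst σ) (o.subst σ)) :
    Simulates X D {σ | σ.dom = s.vars ∪ o.vars ∧ p σ} (pathSol G (.bgp {⟨s, E, o⟩})) := by
  simp only [pathSol_singleton, h, PTriple.vars, hE, Set.union_empty]
  exact .of_disjoint fun σ hσ => hσ.1 ▸ Set.disjoint_union_left.2 ⟨hs, ho⟩

end TauTriple

open scoped Classical in
theorem simulates_tauTriple {X : Set B} (G : Set (Triple N L B)) {t : Triple N L B}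
    (ht : t.IsRDF) (hX : Disjoint t.vars X) {x y : B} (hx : x ∈ X) (hy : y ∈ X) (hxy : x ≠ y) :
    Simulates X {x, y} {σ | σ.dom = t.vars ∧ Holds G (t.subst σ)}
      (pathSol G (tauTriple x y t)) := by
  obtain ⟨s, p, o⟩ := t
  obtain ⟨-, a, rfl⟩ := ht
  have hv : Triple.vars (⟨s, .uri a, o⟩ : Triple N L B) = s.vars ∪ o.vars := by
    simp [Triple.vars, Term.vars]
  rw [hv] at hX ⊢
  obtain ⟨hs, ho⟩ := Set.disjoint_union_left.1 hX
  have plain : ∀ a : Uri N, IsPlain (.uri a : Term N L B) → Simulates X {x, y}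
      {σ | σ.dom = s.vars ∪ o.vars ∧ Holds G (Triple.subst σ ⟨s, .uri a, o⟩)}
      (pathSol G (.bgp {⟨s, .letter (.var x), o⟩,
        ⟨.var x, .star (.letter (.uri .sp)), .uri a⟩})) := fun a ha => by
    have := (simulates_tau_plain G hs ho hx a).mono (Set.singleton_subset_iff.2 <|
      Set.mem_insert x {y})
    simp only [← closureExt_of_isPlain G ha] at this
    exact this
  cases a with
  | sc =>
    exact simulates_singleton G hs ho (by simp [PathExpr.vars, Term.vars]) fun σ => (pathRel_plus ..).symm
  | sp =>
    exact simulates_singleton G hs ho (by simp [PathExpr.vars, Term.vars]) fun σ => (pathRel_plus ..).symm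
  | type =>
    have h₁ : Simulates X {x, y} {σ | σ.dom = s.vars ∪ o.vars ∧ ∃ c,
        Edge G (.uri .type) (s.subst σ) c ∧ ReflTransGen (Edge G (.uri .sc)) c (o.subst σ)} _ :=
      simulates_singleton G hs ho
        (E := .seq (.letter (.uri .type)) (.star (.letter (.uri .sc))))
        (by simp [PathExpr.vars, Term.vars]) fun σ => by
          simp only [← pathRel_star]
          exact (pathRel_seq ..).symm
    -- The three disjuncts of `DirectType` are the three alternatives of the expansion, once the
    -- quantifier over the class is distributed over them.
    convert h₁.union ((simulates_tau_dom G hs ho hx hy hxy).union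
      (simulates_tau_range G hs ho hx hy hxy)) using 1
    · ext σ
      refine Iff.trans (and_congr_right' ?_) (and_or_left.trans (or_congr_right and_or_left))
      refine Iff.trans ?_ (exists_or.trans (or_congr_right exists_or))
      simp only [← or_and_right]
      rfl
    · rfl
  | dom => exact plain _ ⟨nofun, nofun, nofun⟩
  | range => exact plain _ ⟨nofun, nofun, nofun⟩
  | name n => exact plain _ ⟨nofun, nofun, nofun⟩

/-! ### The rewriting of a pattern -/

/-- Each condition depends only on the variables of its own domain, so a map satisfying both is the
union of its two restrictions. This turns a basic graph pattern into the AND of its triples. -/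
theorem join_setOf {A A' : Set B} {p p' : PMap N L B → Prop}
    (hp : ∀ σ σ' : PMap N L B, (∀ b ∈ A, σ b = σ' b) → p σ → p σ')
    (hp' : ∀ σ σ' : PMap N L B, (∀ b ∈ A', σ b = σ' b) → p' σ → p' σ') :
    join {σ | σ.dom = A ∧ p σ} {σ | σ.dom = A' ∧ p' σ} =
      {σ | σ.dom = A ∪ A' ∧ p σ ∧ p' σ} := by
  ext σ
  constructor
  · rintro ⟨σ₁, ⟨rfl, h₁⟩, σ₂, ⟨rfl, h₂⟩, hc, rfl⟩
    exact ⟨PMap.dom_merge σ₁ σ₂, hp σ₁ _ (fun b hb => (PMap.merge_apply_left hb).symm) h₁,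
      hp' σ₂ _ (fun b hb => (PMap.merge_apply_right hc hb).symm) h₂⟩
  · rintro ⟨hd, h₁, h₂⟩
    have key : ∀ A : Set B, ∀ b ∈ A, σ b = σ.forget Aᶜ b := fun A b hb =>
      (PMap.forget_apply (not_not.2 hb) σ).symm
    -- Forgetting the complement of `A` is restriction to `A`.
    refine ⟨σ.forget Aᶜ, ⟨?_, hp σ _ (key A) h₁⟩, σ.forget A'ᶜ, ⟨?_, hp' σ _ (key A') h₂⟩, ?_, ?_⟩
    · rw [PMap.dom_forget, hd, Set.sdiff_compl, Set.union_inter_cancel_left]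
    · rw [PMap.dom_forget, hd, Set.sdiff_compl, Set.union_inter_cancel_right]
    · intro b hb hb'
      rw [PMap.dom_forget, Set.sdiff_compl] at hb hb'
      rw [← key A b hb.2, ← key A' b hb'.2]
    · funext b
      by_cases hb : b ∈ A
      · cases h : σ b <;> by_cases hb' : b ∈ A' <;> simp [PMap.merge, PMap.forget, hb, hb', h]
      · by_cases hb' : b ∈ A'
        · simp [PMap.merge, PMap.forget, hb, hb']
        · have : σ b = none := not_not.1 fun h => (hd ▸ h : b ∈ A ∪ A').elim hb hb'
          simp [PMap.merge, PMap.forget, this]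

theorem evenPart_injective {f : ℕ → B} (hf : f.Injective) : (evenPart f).Injective :=
  fun m n h => by have := hf h; omega

theorem oddPart_injective {f : ℕ → B} (hf : f.Injective) : (oddPart f).Injective :=
  fun m n h => by have := hf h; omega

theorem range_evenPart_subset (f : ℕ → B) : Set.range (evenPart f) ⊆ Set.range f :=
  Set.range_subset_iff.2 fun n => ⟨2 * n, rfl⟩

theorem range_oddPart_subset (f : ℕ → B) : Set.range (oddPart f) ⊆ Set.range f :=
  Set.range_subset_iff.2 fun n => ⟨2 * n + 1, rfl⟩

theorem disjoint_range_evenPart_oddPart {f : ℕ → B} (hf : f.Injective) :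
    Disjoint (Set.range (evenPart f)) (Set.range (oddPart f)) := by
  rw [Set.disjoint_left]
  rintro _ ⟨m, rfl⟩ ⟨n, h⟩
  have := hf h
  omega

theorem simulates_tauList {X : Set B} (G : Set (Triple N L B)) (ts : List (Triple N L B))
    (ht : ∀ t ∈ ts, t.IsRDF) (hX : ∀ t ∈ ts, Disjoint t.vars X) {f : ℕ → B}
    (hf : f.Injective) (hfX : Set.range f ⊆ X) :
    Simulates X (Set.range f)
      {σ | σ.dom = {b | ∃ t ∈ ts, b ∈ t.vars} ∧ ∀ t ∈ ts, Holds G (t.subst σ)}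
      (pathSol G (tauList f ts)) := by
  induction ts generalizing f with
  | nil =>
    have : pathSol G (tauList f []) =
        {σ | σ.dom = {b | ∃ t ∈ ([] : List (Triple N L B)), b ∈ t.vars} ∧
          ∀ t ∈ ([] : List (Triple N L B)), Holds G (t.subst σ)} := by
      rw [tauList, pathSol_bgp]
      simp
    rw [this]
    exact .of_disjoint fun σ hσ => by rw [hσ.1]; simp
  | cons t ts ih =>
    have he := range_evenPart_subset f
    have ho := range_oddPart_subset f
    have h₁ := (simulates_tauTriple G (ht t (by simp)) (hX t (by simp))
      (hfX (he ⟨0, rfl⟩)) (hfX (he ⟨1, rfl⟩)) ((evenPart_injective hf).ne zero_ne_one)).mono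
      (Set.insert_subset ⟨0, rfl⟩ (Set.singleton_subset_iff.2 ⟨1, rfl⟩) :
        _ ⊆ Set.range (evenPart f))
    have h₂ := ih (fun u hu => ht u (by simp [hu])) (fun u hu => hX u (by simp [hu]))
      (oddPart_injective hf) (ho.trans hfX)
    have h := (h₁.join h₂ (disjoint_range_evenPart_oddPart hf)).mono (Set.union_subset he ho)
    rw [join_setOf] at h
    · have he : {σ : PMap N L B | σ.dom = {b | ∃ u ∈ t :: ts, b ∈ u.vars} ∧
          ∀ u ∈ t :: ts, Holds G (u.subst σ)} =
          {σ | σ.dom = t.vars ∪ {b | ∃ u ∈ ts, b ∈ u.vars} ∧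
            Holds G (t.subst σ) ∧ ∀ u ∈ ts, Holds G (u.subst σ)} := by
        simp only [List.mem_cons, exists_eq_or_imp, forall_eq_or_imp, Set.union_def,
          Set.mem_ofPred_eq]
      rw [he]
      exact h
    · intro σ σ' h
      rw [Triple.subst_congr h]
      exact id
    · intro σ σ' h h' u hu
      rw [← Triple.subst_congr fun b hb => h b ⟨u, hu, hb⟩]
      exact h' u hu

/-- The set `X` stays fixed while the supply `f` is split, so both subpatterns are compared after
the same forgetting and the disjoint halves serve as their sets `D`. -/
theorem simulates_tau {X : Set B} {G : Set (Triple N L B)} (hG : IsGenuine G)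
    (P : SPattern N L B) (hP : P.AllTriples Triple.IsRDF) (hX : Disjoint (P.vars Triple.vars) X)
    {f : ℕ → B} (hf : f.Injective) (hfX : Set.range f ⊆ X) :
    Simulates X (Set.range f) (rdfsSol G P) (pathSol G (tau f P)) := by
  have he := range_evenPart_subset f
  have ho := range_oddPart_subset f
  have hD := disjoint_range_evenPart_oddPart hf
  induction P generalizing f with
  | bgp F =>
    have h := simulates_tauList (X := X) G F.toList (fun t ht => hP t (Finset.mem_toList.1 ht))
      (fun t ht => hX.mono_left fun b hb => Exists.intro t ⟨Finset.mem_toList.1 ht, hb⟩) hf hfX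
    simp only [Finset.mem_toList] at h
    have hF : rdfsSol G (.bgp F) = {σ | σ.dom = {b | ∃ t ∈ F, b ∈ t.vars} ∧
        ∀ t ∈ F, Holds G (t.subst σ)} := by
      ext σ
      refine and_congr_right' ((nrxEntails_iff hG _).trans ⟨fun h t ht => h _ ⟨t, ht, rfl⟩, ?_⟩)
      rintro h _ ⟨t, ht, rfl⟩
      exact h t ht
    rw [hF]
    exact h
  | and P Q ihP ihQ | union P Q ihP ihQ | opt P Q ihP ihQ =>
    obtain ⟨hXP, hXQ⟩ := Set.disjoint_union_left.1 hX
    have h₁ := ihP hP.1 hXP (evenPart_injective hf) (he.trans hfX) (range_evenPart_subset _)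
      (range_oddPart_subset _) (disjoint_range_evenPart_oddPart (evenPart_injective hf))
    have h₂ := ihQ hP.2 hXQ (oddPart_injective hf) (ho.trans hfX) (range_evenPart_subset _)
      (range_oddPart_subset _) (disjoint_range_evenPart_oddPart (oddPart_injective hf))
    first
    | exact (h₁.join h₂ hD).mono (Set.union_subset he ho)
    | exact (h₁.mono he).union (h₂.mono ho)
    | exact ((h₁.join h₂ hD).mono (Set.union_subset he ho)).union ((h₁.diff h₂ hD).mono he)
  | filter P K ih =>
    obtain ⟨hXP, hXK⟩ := Set.disjoint_union_left.1 hX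
    exact (ih hP hXP hf hfX he ho hD).filter K fun b hb => Set.disjoint_left.1 hXK hb

theorem answers_tau {G : Set (Triple N L B)} (hG : IsGenuine G) (V : List B)
    (P : SPattern N L B) (hP : P.AllTriples Triple.IsRDF) {fresh : ℕ → B}
    (hf : IsFresh V P fresh) :
    answersRDFS V G P = answersPSPARQL V G (tau fresh P) := by
  have hX : Disjoint (P.vars Triple.vars) (Set.range fresh) := by
    rw [Set.disjoint_right]
    rintro _ ⟨n, rfl⟩
    exact hf.not_pattern n
  have hV : ∀ b ∈ V, b ∉ Set.range fresh := by
    rintro _ hb ⟨n, rfl⟩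
    exact hf.not_select n hb
  have h := (simulates_tau hG P hP hX hf.inj le_rfl).image
  change PMap.project V '' rdfsSol G P = PMap.project V '' pathSol G (tau fresh P)
  rw [← h, Set.image_image]
  simp only [PMap.project_forget hV]

/-! ### Existence of new variables -/

theorem Term.finite_vars (t : Term N L B) : t.vars.Finite := by
  cases t <;> simp [Term.vars]

theorem Triple.finite_vars (t : Triple N L B) : t.vars.Finite :=
  (t.s.finite_vars.union t.p.finite_vars).union t.o.finite_vars

theorem Pattern.finite_vars {Y : Type u} {tv : Y → Set B} (htv : ∀ t, (tv t).Finite)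
    (P : Pattern N L B Y) : (P.vars tv).Finite := by
  induction P with
  | bgp F =>
    have : (Pattern.bgp F : Pattern N L B Y).vars tv = ⋃ t ∈ F, tv t := by
      ext b
      simp [Pattern.vars]
    rw [this]
    exact F.finite_toSet.biUnion fun t _ => htv t
  | and P Q ihP ihQ | union P Q ihP ihQ | opt P Q ihP ihQ => exact ihP.union ihQ
  | filter P K ih => exact ih.union K.vars.finite_toSet

/-- A query mentions finitely many variables, so infinitely many remain. -/
theorem exists_isFresh [Infinite B] (V : List B) (P : SPattern N L B) :
    ∃ fresh : ℕ → B, IsFresh V P fresh := by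
  have h : ({b | b ∈ V} ∪ P.vars Triple.vars)ᶜ.Infinite :=
    (V.finite_toSet.union (P.finite_vars Triple.finite_vars)).infinite_compl
  exact ⟨fun n => h.natEmbedding _ n, Subtype.val_injective.comp (h.natEmbedding _).injective,
    fun n hn => (h.natEmbedding _ n).2 (.inl hn), fun n hn => (h.natEmbedding _ n).2 (.inr hn)⟩

end SparqlRdfs

theorem mainTheorem5 {N L B : Type u} [Infinite B]
    (G : Set (SparqlRdfs.Triple N L B)) (hG : SparqlRdfs.IsRDFGraph G)
    (hgen : SparqlRdfs.IsGenuine G)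
    (V : List B) (P : SparqlRdfs.SPattern N L B)
    (hP : P.AllTriples SparqlRdfs.Triple.IsRDF) :
    (∃ fresh : ℕ → B, SparqlRdfs.IsFresh V P fresh) ∧
      ∀ fresh : ℕ → B, SparqlRdfs.IsFresh V P fresh →
        SparqlRdfs.answersRDFS V G P =
          SparqlRdfs.answersPSPARQL V G (SparqlRdfs.tau fresh P) :=
  ⟨SparqlRdfs.exists_isFresh V P, fun _ hf => SparqlRdfs.answers_tau hgen V P hP hf⟩
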